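/- **Setting.** Fix integers $d, M, T \ge 1$ and let the arm space be $\mathcal X=[0,1]^d$ with the distance $\|x-y\|_\infty$. A federated $\mathcal X$-armed bandit instance with $M$ clients consists of, for every client $m\in[M]$ and arm $x\in\mathcal X$, a reward distribution $\nu_m(x)$ on $[0,1]$ (measurable in $x$). The local objective of client $m$ is the mean reward $f_m(x)=\int r\,\nu_m(x)(\mathrm dr)$ and the global objective is $f=\frac1M\sum_{m=1}^M f_m$. In each round $t=1,\dots,T$ every client $m$ pulls an arm $x_{m,t}$ and receives a reward $r_{m,t}\sim\nu_m(x_{m,t})$; given the arms pulled in round $t$, the rewards of that round are independent of each other and of the past. Policies $\pi_1,\dots,\pi_M$ choose each $x_{m,t}$ as a measurable function of the arms and rewards of all $M$ clients in rounds $1,\dots,t-1$ (arbitrary communication between rounds is allowed) and of a random seed with an arbitrary law, which is independent of the instance (arbitrary private or shared randomization). The cumulative regret is $$R(T)=\sum_{t=1}^T\sum_{m=1}^M\Bigl(\sup_{x\in\mathcal X} f(x)-f(x_{m,t})\Bigr).$$ **Theorem.** There is an absolute constant $c>0$ such that for all $d,M,T\ge1$ and all policies $\pi_1,\dots,\pi_M$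 of the $M$ clients on $[0,1]^d$, there is a federated $\mathcal X$-armed bandit instance with identical local objectives, $f_m=f$ for all $m\in[M]$, and with $f$ $1$-Lipschitz with respect to $\|\cdot\|_\infty$, for which $$\mathbb E_{\pi_1,\dots,\pi_M}\bigl[R(T)\bigr]\;\ge\; c\,M^{\frac{d+1}{d+2}}\,T^{\frac{d+1}{d+2}}.$$ -/

import Mathlib

open MeasureTheory ProbabilityTheory

namespace FedBandit

noncomputable section

/-- The `d`-dimensional arm space `[0,1]^d`. As a finite product of copies of `[0,1]` it carries the
sup-norm distance and the Borel (product) sigma-algebra. -/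
abbrev Cube (d : ℕ) : Type := Fin d → unitInterval

/-- A federated bandit instance with arm space `X` and `M` clients. When client `m` pulls the arm
`x` it receives a random reward in `[0,1]` with law `reward m x`. -/
structure Instance (X : Type) [MeasurableSpace X] (M : ℕ) where
  reward : Fin M → Kernel X ℝ
  isMarkov : ∀ m, IsMarkovKernel (reward m)
  bounded : ∀ m x, ∀ᵐ r ∂(reward m x), r ∈ Set.Icc (0 : ℝ) 1

/-- What happened in the rounds `0, …, t - 1`: for every round and every client, the arm that the
client pulled and the reward that it received. -/
abbrev History (X : Type) (M t : ℕ) : Type := Fin t → Fin M → X × ℝ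

/-- The policies of `M` clients. The seed in `S` is the source of all randomization, private or
shared (`S` may be a product with one factor for each client). In round `t`, client `m` pulls the
arm `act m t (s, h)`, where `s` is the seed and `h` is the history of *all* clients in the previous
rounds: communication between rounds is unrestricted, and there is none within a round. -/
structure Policy (S : Type*) [MeasurableSpace S] (X : Type) [MeasurableSpace X] (M : ℕ) where
  act : Fin M → (t : ℕ) → S × History X M t → X
  measurable_act : ∀ m t, Measurable (act m t)

section Instances

variable {X : Type} [MeasurableSpace X] {M : ℕ}

/-- The local objective `f_m` of client `m`: the mean reward of each arm. -/
def Instance.localObjective (I : Instance X M) (m : Fin M) (x : X) : ℝ :=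
  ∫ r, r ∂(I.reward m x)

/-- The global objective `f`: the average of the local objectives. -/
def Instance.globalObjective (I : Instance X M) (x : X) : ℝ :=
  (∑ m, I.localObjective m x) / M

/-- The cumulative regret of all clients along a history, measured by the global objective. -/
def Instance.regret (I : Instance X M) {T : ℕ} (h : History X M T) : ℝ :=
  ∑ t, ∑ m, ((⨆ x, I.globalObjective x) - I.globalObjective (h t m).1)

theorem Instance.measurable_pi_reward (I : Instance X M) :
    Measurable (fun x : Fin M → X => Measure.pi (fun m => I.reward m (x m))) := by
  have := I.isMarkov
  refine Measurable.measure_of_isPiSystem_of_isProbabilityMeasure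
    generateFrom_pi.symm isPiSystem_pi ?_
  rintro _ ⟨s, hs, rfl⟩
  simp only [Measure.pi_pi]
  exact Finset.measurable_prod _ fun m _ =>
    ((I.reward m).measurable_coe (hs m (Set.mem_univ m))).comp (measurable_pi_apply m)

/-- Given the arms pulled in a round, the rewards of the clients are independent, and the reward of
client `m` has law `I.reward m (x m)`. -/
def Instance.roundRewards (I : Instance X M) : Kernel (Fin M → X) (Fin M → ℝ) where
  toFun x := Measure.pi (fun m => I.reward m (x m))
  measurable' := I.measurable_pi_reward

end Instances

section Interaction

variable {S : Type*} [MeasurableSpace S] {X : Type} [MeasurableSpace X] {M : ℕ}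

/-- The arms pulled by all clients in round `t`. -/
def Policy.arms (π : Policy S X M) (t : ℕ) (p : S × History X M t) : Fin M → X :=
  fun m => π.act m t p

theorem Policy.measurable_arms (π : Policy S X M) (t : ℕ) : Measurable (π.arms t) :=
  measurable_pi_lambda _ fun m => π.measurable_act m t

/-- Append round `t`, with the given rewards, to the history. -/
def Policy.extend (π : Policy S X M) (t : ℕ)
    (q : S × (History X M t × (Fin M → ℝ))) : History X M (t + 1) :=
  Fin.snoc (α := fun _ => Fin M → X × ℝ) q.2.1 fun m => (π.act m t (q.1, q.2.1), q.2.2 m)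

theorem Policy.measurable_extend (π : Policy S X M) (t : ℕ) : Measurable (π.extend t) := by
  refine measurable_pi_lambda _ fun i => ?_
  refine Fin.lastCases ?_ (fun j => ?_) i
  · simp only [Policy.extend, Fin.snoc_last]
    refine measurable_pi_lambda _ fun m => ?_
    have := π.measurable_act m t
    fun_prop
  · simp only [Policy.extend, Fin.snoc_castSucc]
    fun_prop

/-- The conditional law, given the seed, of the history of the first `t` rounds when the clients
follow the policies `π` on the instance `I`. -/
def historyKernel (π : Policy S X M) (I : Instance X M) : (t : ℕ) → Kernel S (History X M t)
  | 0 => Kernel.const S (Measure.dirac Fin.elim0)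
  | t + 1 =>
      (Kernel.id ×ₖ
        (historyKernel π I t ⊗ₖ I.roundRewards.comap (π.arms t) (π.measurable_arms t))).map
          (π.extend t)

/-- The law of the history of the first `T` rounds, for a seed with law `P`. -/
def historyLaw (P : Measure S) (π : Policy S X M) (I : Instance X M) (T : ℕ) :
    Measure (History X M T) :=
  P.bind (historyKernel π I T)

/-- The expected cumulative regret over `T` rounds. -/
def expectedRegret (P : Measure S) (π : Policy S X M) (I : Instance X M) (T : ℕ) : ℝ :=
  ∫ h, I.regret h ∂(historyLaw P π I T)

end Interaction

end

end FedBandit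

/-!
Hide a cone-shaped bump of height and radius `ε ≍ 1 / K` at one of the `K ^ d` cell centres of a
grid in `[0,1]^d`. Facing fair coins only, the clients make `M * T` pulls, hence on average at
most `M * T / K ^ d` of them in some cell. A bump in that cell changes the law of the rewards only
at those pulls, each time by a Kullback-Leibler divergence of order `ε ^ 2`, and by the chain rule
the divergence between the two laws of the whole history is at most of order
`ε ^ 2 * M * T / K ^ d`; communication and shared randomness do not enter, since the arms of a
round are a function of the seed and of the history. When `K ^ (d + 2) ≍ M * T` this is a small
constant, so that by a Pinsker-type inequality the clients still make a constant fraction of their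
pulls outside the bump, at a regret of `ε` each, which amounts to
`ε * M * T ≍ (M * T) ^ ((d + 1) / (d + 2))`.
-/

namespace FedBandit

noncomputable section

section KullbackLeibler

open InformationTheory
open scoped ENNReal

variable {α β : Type*} [MeasurableSpace α] [MeasurableSpace β]

theorem klDiv_map_measurableEquiv (e : α ≃ᵐ β) (μ ν : Measure α)
    [IsFiniteMeasure μ] [IsFiniteMeasure ν] : klDiv (μ.map e) (ν.map e) = klDiv μ ν := by
  refine le_antisymm (klDiv_map_le μ ν e.measurable) ?_
  simpa using klDiv_map_le (μ.map e) (ν.map e) e.symm.measurable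

theorem klDiv_prod (μ μ' : Measure α) (ν ν' : Measure β) [IsProbabilityMeasure μ]
    [IsFiniteMeasure μ'] [IsProbabilityMeasure ν] [IsProbabilityMeasure ν'] :
    klDiv (μ.prod ν) (μ'.prod ν') = klDiv μ μ' + klDiv ν ν' := by
  have hsnd : klDiv (μ.prod ν) (μ.prod ν') = klDiv ν ν' := by
    rw [← klDiv_map_measurableEquiv MeasurableEquiv.prodComm]
    change klDiv (Measure.map Prod.swap _) (Measure.map Prod.swap _) = _
    rw [Measure.prod_swap, Measure.prod_swap, ← Measure.compProd_const, ← Measure.compProd_const,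
      klDiv_compProd_left]
  rw [← hsnd]
  simpa only [Measure.compProd_const] using
    klDiv_compProd_eq_add μ μ' (Kernel.const α ν) (Kernel.const α ν')

theorem klDiv_pi_fin {n : ℕ} {γ : Fin n → Type*} [∀ i, MeasurableSpace (γ i)]
    (μ ν : ∀ i, Measure (γ i)) [∀ i, IsProbabilityMeasure (μ i)]
    [∀ i, IsProbabilityMeasure (ν i)] :
    klDiv (Measure.pi μ) (Measure.pi ν) = ∑ i, klDiv (μ i) (ν i) := by
  induction n with
  | zero => rw [Measure.pi_of_empty μ, Measure.pi_of_empty ν, klDiv_self, Fin.sum_univ_zero]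
  | succ n ih =>
    rw [← klDiv_map_measurableEquiv (MeasurableEquiv.piFinSuccAbove γ 0),
      (measurePreserving_piFinSuccAbove μ 0).map_eq, (measurePreserving_piFinSuccAbove ν 0).map_eq,
      klDiv_prod, ih, Fin.sum_univ_succ]
    rfl

theorem klDiv_compProd_eq_lintegral [MeasurableSpace.CountableOrCountablyGenerated α β]
    (μ : Measure α) [IsFiniteMeasure μ] (κ η : Kernel α β) [IsMarkovKernel κ] [IsMarkovKernel η] :
    klDiv (μ ⊗ₘ κ) (μ ⊗ₘ η) = ∫⁻ a, klDiv (κ a) (η a) ∂μ := by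
  by_cases hac : ∀ᵐ a ∂μ, κ a ≪ η a
  · have hdensity : μ ⊗ₘ κ = (μ ⊗ₘ η).withDensity fun p => κ.rnDeriv η p.1 p.2 := by
      rw [← Measure.compProd_withDensity (Kernel.measurable_rnDeriv κ η)]
      refine Measure.compProd_congr ?_
      filter_upwards [hac] with a ha using (Kernel.withDensity_rnDeriv_eq ha).symm
    have hmeas : Measurable fun p : α × β => κ.rnDeriv η p.1 p.2 := Kernel.measurable_rnDeriv κ η
    have hrnDeriv : (μ ⊗ₘ κ).rnDeriv (μ ⊗ₘ η) =ᵐ[μ ⊗ₘ η] fun p => κ.rnDeriv η p.1 p.2 := by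
      rw [hdensity]
      exact Measure.rnDeriv_withDensity _ hmeas
    calc klDiv (μ ⊗ₘ κ) (μ ⊗ₘ η)
        = ∫⁻ p, ENNReal.ofReal (klFun (κ.rnDeriv η p.1 p.2).toReal) ∂(μ ⊗ₘ η) := by
          rw [klDiv_eq_lintegral_klFun_of_ac
            (Measure.absolutelyContinuous_compProd_right_iff.2 hac)]
          exact lintegral_congr_ae (hrnDeriv.mono fun p hp => by simp only [hp])
      _ = ∫⁻ a, ∫⁻ b, ENNReal.ofReal (klFun (κ.rnDeriv η a b).toReal) ∂η a ∂μ :=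
          Measure.lintegral_compProd (by fun_prop)
      _ = ∫⁻ a, klDiv (κ a) (η a) ∂μ := by
          refine lintegral_congr_ae ?_
          filter_upwards [hac] with a ha
          rw [klDiv_eq_lintegral_klFun_of_ac ha]
          exact lintegral_congr_ae ((Kernel.rnDeriv_eq_rnDeriv_measure (κ := κ) (η := η)
            (a := a)).mono fun b hb => by simp only [hb])
  · rw [klDiv_of_not_ac (mt Measure.absolutelyContinuous_compProd_right_iff.1 hac), eq_comm,
      eq_top_iff]
    let A : Set α := {a | κ a ≪ η a}ᶜ
    have hA : MeasurableSet A := (Kernel.measurableSet_absolutelyContinuous κ η).compl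
    calc ∞ = ∫⁻ a, A.indicator (fun _ => ∞) a ∂μ := by
          rw [lintegral_indicator_const hA, ENNReal.top_mul (mt mem_ae_iff.2 hac)]
      _ ≤ ∫⁻ a, klDiv (κ a) (η a) ∂μ :=
          lintegral_mono (Set.indicator_le fun a ha => (klDiv_of_not_ac ha).ge)

theorem klFun_le_sq_sub_one {x : ℝ} (hx : 0 ≤ x) : klFun x ≤ (x - 1) ^ 2 := by
  rcases hx.eq_or_lt with rfl | hx
  · simp [klFun_zero]
  · have := mul_le_mul_of_nonneg_left (Real.log_le_sub_one_of_pos hx) hx.le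
    rw [klFun_apply]
    linarith

theorem klDiv_withDensity_le (ν : Measure α) [IsFiniteMeasure ν] {ρ : α → ℝ} (hρ : Measurable ρ)
    (hρ_nonneg : ∀ a, 0 ≤ ρ a) [IsFiniteMeasure (ν.withDensity fun a => ENNReal.ofReal (ρ a))] :
    klDiv (ν.withDensity fun a => ENNReal.ofReal (ρ a)) ν ≤
      ∫⁻ a, ENNReal.ofReal ((ρ a - 1) ^ 2) ∂ν := by
  rw [klDiv_eq_lintegral_klFun_of_ac (withDensity_absolutelyContinuous _ _)]
  refine lintegral_mono_ae ?_
  filter_upwards [Measure.rnDeriv_withDensity ν hρ.ennreal_ofReal] with a ha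
  rw [ha, ENNReal.toReal_ofReal (hρ_nonneg a)]
  exact ENNReal.ofReal_le_ofReal (klFun_le_sq_sub_one (hρ_nonneg a))

theorem bernoulliMeasure_eq_ofReal_smul_dirac (a b : α) (p : unitInterval) :
    bernoulliMeasure a b p =
      ENNReal.ofReal p • Measure.dirac a + ENNReal.ofReal (1 - p) • Measure.dirac b := by
  have hcoe (q : unitInterval) : ENNReal.ofReal q = unitInterval.toNNReal q :=
    ENNReal.ofReal_coe_nnreal (p := unitInterval.toNNReal q)
  rw [← unitInterval.coe_symm_eq, hcoe, hcoe]
  rfl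

theorem lintegral_ofReal_bernoulliMeasure [MeasurableSingletonClass α] (a b : α) (p : unitInterval)
    {f : α → ℝ} (hf : ∀ x, 0 ≤ f x) :
    ∫⁻ x, ENNReal.ofReal (f x) ∂(bernoulliMeasure a b p) =
      ENNReal.ofReal (p * f a + (1 - p) * f b) := by
  rw [← ofReal_integral_eq_lintegral_ofReal (integrable_bernoulliMeasure a b p f)
    (.of_forall hf), integral_bernoulliMeasure]
  simp only [smul_eq_mul]

theorem klDiv_bernoulliMeasure_le [MeasurableSingletonClass α] {a b : α} (hab : a ≠ b)
    (p : unitInterval) {q : unitInterval} (hq0 : 0 < (q : ℝ)) (hq1 : (q : ℝ) < 1) :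
    klDiv (bernoulliMeasure a b p) (bernoulliMeasure a b q) ≤
      ENNReal.ofReal ((p - q : ℝ) ^ 2 / (q * (1 - q))) := by
  classical
  have hq1' : (0 : ℝ) < 1 - q := sub_pos.2 hq1
  let ρ : α → ℝ := fun x => if x = a then p / q else (1 - p) / (1 - q)
  have hρ_nonneg (x : α) : 0 ≤ ρ x := by
    have := p.2.1
    have := sub_nonneg.2 p.2.2
    simp only [ρ]
    split_ifs <;> positivity
  have hρ : Measurable ρ :=
    Measurable.ite (measurableSet_singleton a) measurable_const measurable_const
  have hdensity : bernoulliMeasure a b p =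
      (bernoulliMeasure a b q).withDensity fun x => ENNReal.ofReal (ρ x) := by
    rw [bernoulliMeasure_eq_ofReal_smul_dirac, bernoulliMeasure_eq_ofReal_smul_dirac,
      withDensity_add_measure, withDensity_smul_measure, withDensity_smul_measure,
      dirac_withDensity, dirac_withDensity, smul_smul, smul_smul,
      ← ENNReal.ofReal_mul hq0.le, ← ENNReal.ofReal_mul hq1'.le]
    simp only [ρ, if_true, hab.symm, if_false, mul_div_cancel₀ _ hq0.ne',
      mul_div_cancel₀ _ hq1'.ne']
  have : IsFiniteMeasure ((bernoulliMeasure a b q).withDensity fun x => ENNReal.ofReal (ρ x)) :=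
    hdensity ▸ inferInstance
  rw [hdensity]
  refine (klDiv_withDensity_le _ hρ hρ_nonneg).trans_eq ?_
  rw [lintegral_ofReal_bernoulliMeasure a b q fun _ => sq_nonneg _]
  simp only [ρ, if_true, hab.symm, if_false]
  congr 1
  field_simp
  ring

theorem sq_sqrt_sub_one_le_klFun {x : ℝ} (hx : 0 ≤ x) : (√x - 1) ^ 2 ≤ klFun x := by
  rcases hx.eq_or_lt with rfl | hx
  · simp [klFun_zero]
  · have hlog : 1 - (√x)⁻¹ ≤ Real.log x / 2 := by
      rw [← Real.log_sqrt hx.le]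
      exact Real.one_sub_inv_le_log_of_pos (Real.sqrt_pos.2 hx)
    have hdiv : x * (√x)⁻¹ = √x := by rw [← div_eq_mul_inv, Real.div_sqrt]
    have := mul_le_mul_of_nonneg_left hlog hx.le
    rw [klFun_apply]
    nlinarith [Real.sq_sqrt hx.le]

theorem abs_sub_one_le_mul_klFun_add {x c : ℝ} (hx : 0 ≤ x) (hc : 0 < c) :
    |x - 1| ≤ c * klFun x + (x + 1) / (2 * c) := by
  have hfactor : |x - 1| = |√x - 1| * (√x + 1) := by
    rw [← abs_of_nonneg (add_nonneg (Real.sqrt_nonneg x) zero_le_one), ← abs_mul]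
    congr 1
    linarith [Real.sq_sqrt hx]
  have hamgm : |√x - 1| * (√x + 1) ≤ c * (√x - 1) ^ 2 + (√x + 1) ^ 2 / (4 * c) := by
    have hsq : c * (√x - 1) ^ 2 + (√x + 1) ^ 2 / (4 * c) - |√x - 1| * (√x + 1) =
        (2 * c * |√x - 1| - (√x + 1)) ^ 2 / (4 * c) := by
      rw [← sq_abs (√x - 1)]
      field_simp
      ring
    have : 0 ≤ (2 * c * |√x - 1| - (√x + 1)) ^ 2 / (4 * c) := by positivity
    linarith
  calc |x - 1| ≤ c * (√x - 1) ^ 2 + (√x + 1) ^ 2 / (4 * c) := hfactor.trans_le hamgm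
    _ ≤ c * klFun x + 2 * (x + 1) / (4 * c) := by
        gcongr
        · exact sq_sqrt_sub_one_le_klFun hx
        · nlinarith [Real.sq_sqrt hx, sq_nonneg (√x - 1)]
    _ = c * klFun x + (x + 1) / (2 * c) := by
        field_simp
        ring

theorem integral_abs_rnDeriv_sub_one_le {μ ν : Measure α} [IsProbabilityMeasure μ]
    [IsProbabilityMeasure ν] (h : klDiv μ ν ≠ ∞) :
    ∫ x, |(μ.rnDeriv ν x).toReal - 1| ∂ν ≤ 2 * √(klDiv μ ν).toReal := by
  obtain ⟨hac, hllr⟩ := klDiv_ne_top_iff.1 h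
  have hkl := (integrable_klFun_rnDeriv_iff hac).2 hllr
  have hr := Measure.integrable_toReal_rnDeriv (μ := μ) (ν := ν)
  have hr1 : Integrable (fun x => |(μ.rnDeriv ν x).toReal - 1|) ν :=
    (hr.sub (integrable_const 1)).abs
  have hr1' : Integrable (fun x => (μ.rnDeriv ν x).toReal + 1) ν := hr.add (integrable_const 1)
  set D := ∫ x, |(μ.rnDeriv ν x).toReal - 1| ∂ν
  set K := (klDiv μ ν).toReal with hK
  have hD : 0 ≤ D := integral_nonneg fun _ => abs_nonneg _
  have hlinear {c : ℝ} (hc : 0 < c) : D ≤ c * K + 1 / c := by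
    calc D ≤ ∫ x, (c * klFun (μ.rnDeriv ν x).toReal +
          ((μ.rnDeriv ν x).toReal + 1) / (2 * c)) ∂ν :=
          integral_mono hr1 ((hkl.const_mul c).add (hr1'.div_const _))
            fun x => abs_sub_one_le_mul_klFun_add ENNReal.toReal_nonneg hc
      _ = c * K + 1 / c := by
          rw [integral_add (hkl.const_mul c) (hr1'.div_const _),
            integral_const_mul, integral_div, integral_add hr (integrable_const 1),
            Measure.integral_toReal_rnDeriv hac, ← toReal_klDiv_eq_integral_klFun hac, ← hK]
          simp only [integral_const, probReal_univ, smul_eq_mul]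
          field_simp
          ring
  have hquad (c : ℝ) : 0 ≤ K * (c * c) + -D * c + 1 := by
    rcases le_or_gt c 0 with hc | hc
    · have : 0 ≤ K := ENNReal.toReal_nonneg
      nlinarith [mul_nonneg this (mul_self_nonneg c)]
    · have := mul_le_mul_of_nonneg_right (hlinear hc) hc.le
      rw [add_mul, one_div_mul_cancel hc.ne'] at this
      linarith
  have := discrim_le_zero hquad
  rw [discrim] at this
  have hKD : (D / 2) ^ 2 ≤ K := by linarith
  linarith [Real.le_sqrt_of_sq_le hKD]

theorem abs_integral_sub_integral_le {μ ν : Measure α} [IsProbabilityMeasure μ]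
    [IsProbabilityMeasure ν] (h : klDiv μ ν ≠ ∞) {f : α → ℝ} (hf : Measurable f) {B : ℝ}
    (hB : ∀ x, |f x| ≤ B) :
    |∫ x, f x ∂μ - ∫ x, f x ∂ν| ≤ 2 * B * √(klDiv μ ν).toReal := by
  obtain ⟨hac, -⟩ := klDiv_ne_top_iff.1 h
  have hint (ρ : Measure α) [IsFiniteMeasure ρ] : Integrable f ρ :=
    .of_bound hf.aestronglyMeasurable B (.of_forall hB)
  have hr := Measure.integrable_toReal_rnDeriv (μ := μ) (ν := ν)
  have hdiff : ∫ x, f x ∂μ - ∫ x, f x ∂ν = ∫ x, ((μ.rnDeriv ν x).toReal - 1) * f x ∂ν := by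
    rw [← integral_rnDeriv_smul hac, ← integral_sub ((integrable_rnDeriv_smul_iff hac).2 (hint μ))
      (hint ν)]
    simp only [smul_eq_mul, sub_mul, one_mul]
  have hB0 : 0 ≤ B := by
    obtain ⟨x⟩ := nonempty_of_isProbabilityMeasure ν
    exact (abs_nonneg _).trans (hB x)
  calc |∫ x, f x ∂μ - ∫ x, f x ∂ν|
      ≤ ∫ x, |(μ.rnDeriv ν x).toReal - 1| * B ∂ν := by
        rw [hdiff, ← Real.norm_eq_abs]
        refine norm_integral_le_of_norm_le ((hr.sub (integrable_const 1)).abs.mul_const B)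
          (.of_forall fun x => ?_)
        rw [Real.norm_eq_abs, abs_mul]
        exact mul_le_mul_of_nonneg_left (hB x) (abs_nonneg _)
    _ ≤ 2 * B * √(klDiv μ ν).toReal := by
        rw [integral_mul_const, mul_comm 2 B, mul_assoc, mul_comm B]
        exact mul_le_mul_of_nonneg_right (integral_abs_rnDeriv_sub_one_le h) hB0

end KullbackLeibler

section Pulls

variable {X : Type} {M t : ℕ}

/-- The sum of `φ m x` over all the pulls of a history, where `m` is the client and `x` the arm. -/
def pullSum {R : Type*} [AddCommMonoid R] (φ : Fin M → X → R) (h : History X M t) : R :=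
  ∑ i, ∑ m, φ m (h i m).1

/-- The number of pulls of arms in `C`, over all rounds and clients of a history. -/
def pullCount (C : Set X) (h : History X M t) : ℝ :=
  pullSum (fun _ => C.indicator 1) h

theorem pullCount_nonneg (C : Set X) (h : History X M t) : 0 ≤ pullCount C h := by
  unfold pullCount pullSum
  exact Finset.sum_nonneg fun _ _ => Finset.sum_nonneg fun _ _ =>
    Set.indicator_nonneg (fun _ _ => zero_le_one) _

theorem pullCount_le (C : Set X) (h : History X M t) : pullCount C h ≤ t * M := by
  unfold pullCount pullSum
  calc ∑ i, ∑ m, C.indicator (1 : X → ℝ) (h i m).1 ≤ ∑ _i : Fin t, ∑ _m : Fin M, (1 : ℝ) :=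
        Finset.sum_le_sum fun _ _ => Finset.sum_le_sum fun _ _ =>
          Set.indicator_le_self' (fun _ _ => zero_le_one) _
    _ = t * M := by simp

theorem sum_pullCount_le {ι : Type*} [Fintype ι] {C : ι → Set X}
    (hC : Pairwise (Function.onFun Disjoint C)) (h : History X M t) :
    ∑ i, pullCount (C i) h ≤ t * M := by
  have hunion : ∑ i, pullCount (C i) h = pullCount (⋃ i ∈ Finset.univ, C i) h := by
    simp only [pullCount, pullSum,
      Finset.indicator_biUnion_apply Finset.univ C fun _ _ _ _ hij => hC hij]
    rw [Finset.sum_comm]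
    exact Finset.sum_congr rfl fun _ _ => Finset.sum_comm
  exact hunion.trans_le (pullCount_le _ h)

variable [MeasurableSpace X]

theorem measurable_pullSum {R : Type*} [AddCommMonoid R] [MeasurableSpace R] [MeasurableAdd₂ R]
    {φ : Fin M → X → R} (hφ : ∀ m, Measurable (φ m)) :
    Measurable (pullSum φ : History X M t → R) := by
  unfold pullSum; fun_prop

theorem measurable_pullCount {C : Set X} (hC : MeasurableSet C) :
    Measurable (pullCount C : History X M t → ℝ) :=
  measurable_pullSum (fun _ => measurable_one.indicator hC)

theorem integrable_pullCount {C : Set X} (hC : MeasurableSet C)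
    (μ : Measure (History X M t)) [IsFiniteMeasure μ] : Integrable (pullCount C) μ :=
  .of_bound (measurable_pullCount hC).aestronglyMeasurable (t * M) <| .of_forall fun h => by
    rw [Real.norm_of_nonneg (pullCount_nonneg C h)]
    exact pullCount_le C h

theorem exists_integral_pullCount_le {ι : Type*} [Fintype ι] [Nonempty ι] {C : ι → Set X}
    (hC : ∀ i, MeasurableSet (C i)) (hdisj : Pairwise (Function.onFun Disjoint C))
    (μ : Measure (History X M t)) [IsProbabilityMeasure μ] :
    ∃ i, ∫ h, pullCount (C i) h ∂μ ≤ t * M / Fintype.card ι := by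
  have htotal : ∑ i, ∫ h, pullCount (C i) h ∂μ ≤ t * M := by
    have hint : ∀ i ∈ Finset.univ, Integrable (pullCount (C i)) μ :=
      fun i _ => integrable_pullCount (hC i) μ
    rw [← integral_finsetSum _ hint]
    simpa using integral_mono (integrable_finsetSum _ hint) (integrable_const _)
      (sum_pullCount_le hdisj)
  have hcard : (Fintype.card ι : ℝ) ≠ 0 := Nat.cast_ne_zero.2 Fintype.card_ne_zero
  obtain ⟨i, -, hi⟩ := Finset.exists_le_of_sum_le Finset.univ_nonempty
    (g := fun _ : ι => (t * M / Fintype.card ι : ℝ))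
    (by simpa [mul_div_cancel₀ _ hcard] using htotal)
  exact ⟨i, hi⟩

end Pulls

section Histories

open InformationTheory
open scoped ENNReal

variable {S : Type*} [MeasurableSpace S] {X : Type} [MeasurableSpace X] {M : ℕ}

instance Instance.isMarkovKernel_reward (I : Instance X M) (m : Fin M) :
    IsMarkovKernel (I.reward m) := I.isMarkov m

theorem Instance.roundRewards_apply (I : Instance X M) (x : Fin M → X) :
    I.roundRewards x = Measure.pi fun m => I.reward m (x m) := rfl

instance Instance.isMarkovKernel_roundRewards (I : Instance X M) :
    IsMarkovKernel I.roundRewards :=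
  ⟨fun x => by rw [I.roundRewards_apply]; infer_instance⟩

instance isMarkovKernel_historyKernel (π : Policy S X M) (I : Instance X M) (t : ℕ) :
    IsMarkovKernel (historyKernel π I t) := by
  induction t with
  | zero => rw [historyKernel]; infer_instance
  | succ t ih => rw [historyKernel]; exact Kernel.IsMarkovKernel.map _ (π.measurable_extend t)

instance isProbabilityMeasure_historyLaw (P : Measure S) [IsProbabilityMeasure P]
    (π : Policy S X M) (I : Instance X M) (T : ℕ) :
    IsProbabilityMeasure (historyLaw P π I T) := by
  unfold historyLaw; infer_instance

/-- The joint law of the seed and of the history of the first `t` rounds. Given this pair, the arms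
of the next round are deterministic. -/
def seedHistoryLaw (P : Measure S) (π : Policy S X M) (I : Instance X M) (t : ℕ) :
    Measure (S × History X M t) :=
  P ⊗ₘ historyKernel π I t

instance isProbabilityMeasure_seedHistoryLaw (P : Measure S) [IsProbabilityMeasure P]
    (π : Policy S X M) (I : Instance X M) (t : ℕ) :
    IsProbabilityMeasure (seedHistoryLaw P π I t) := by
  unfold seedHistoryLaw; infer_instance

theorem map_snd_seedHistoryLaw (P : Measure S) [SFinite P] (π : Policy S X M) (I : Instance X M)
    (t : ℕ) : (seedHistoryLaw P π I t).map Prod.snd = historyLaw P π I t :=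
  Measure.snd_compProd P (historyKernel π I t)

theorem historyKernel_succ_apply (π : Policy S X M) (I : Instance X M) (t : ℕ) (s : S) :
    historyKernel π I (t + 1) s =
      ((historyKernel π I t s) ⊗ₘ
        (I.roundRewards.comap (π.arms t) (π.measurable_arms t)).sectR s).map
          (fun q => π.extend t (s, q)) := by
  rw [historyKernel, Kernel.map_apply _ (π.measurable_extend t), Kernel.prod_apply,
    Kernel.id_apply, Measure.dirac_prod, Kernel.compProd_apply_eq_compProd_sectR,
    Measure.map_map (π.measurable_extend t) measurable_prodMk_left]
  rfl

theorem seedHistoryLaw_succ (P : Measure S) [IsProbabilityMeasure P] (π : Policy S X M)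
    (I : Instance X M) (t : ℕ) :
    seedHistoryLaw P π I (t + 1) =
      (seedHistoryLaw P π I t ⊗ₘ I.roundRewards.comap (π.arms t) (π.measurable_arms t)).map
        fun q => (q.1.1, π.extend t (q.1.1, q.1.2, q.2)) := by
  have hextend := π.measurable_extend t
  refine Measure.ext_of_lintegral _ fun g hg => ?_
  rw [lintegral_map hg (by fun_prop), Measure.lintegral_compProd (by fun_prop), seedHistoryLaw,
    seedHistoryLaw, Measure.lintegral_compProd hg, Measure.lintegral_compProd]
  · refine lintegral_congr fun s => ?_
    rw [historyKernel_succ_apply, lintegral_map (by fun_prop) (by fun_prop),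
      Measure.lintegral_compProd (by fun_prop)]
    rfl
  · exact Measurable.lintegral_kernel_prod_right'
      (f := fun q : (S × History X M t) × (Fin M → ℝ) =>
        g (q.1.1, π.extend t (q.1.1, q.1.2, q.2))) (by fun_prop)

theorem pullSum_extend {R : Type*} [AddCommMonoid R] (φ : Fin M → X → R) (π : Policy S X M)
    (t : ℕ) (q : S × (History X M t × (Fin M → ℝ))) :
    pullSum φ (π.extend t q) = pullSum φ q.2.1 + ∑ m, φ m (π.act m t (q.1, q.2.1)) := by
  simp [pullSum, Policy.extend, Fin.sum_univ_castSucc]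

theorem klDiv_seedHistoryLaw_le (P : Measure S) [IsProbabilityMeasure P] (π : Policy S X M)
    (I J : Instance X M) {D : Fin M → X → ℝ≥0∞} (hD : ∀ m, Measurable (D m))
    (hIJ : ∀ m x, klDiv (I.reward m x) (J.reward m x) ≤ D m x) (t : ℕ) :
    klDiv (seedHistoryLaw P π I t) (seedHistoryLaw P π J t) ≤
      ∫⁻ q, pullSum D q.2 ∂(seedHistoryLaw P π I t) := by
  induction t with
  | zero => simp [seedHistoryLaw, historyKernel]
  | succ t ih =>
    have hextend := π.measurable_extend t
    have hsum : ∀ t, Measurable (pullSum D : History X M t → ℝ≥0∞) := fun _ =>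
      measurable_pullSum hD
    have hround (q : S × History X M t) :
        klDiv (I.roundRewards (π.arms t q)) (J.roundRewards (π.arms t q)) ≤
          ∑ m, D m (π.act m t q) := by
      rw [I.roundRewards_apply, J.roundRewards_apply, klDiv_pi_fin]
      exact Finset.sum_le_sum fun m _ => hIJ m _
    calc klDiv (seedHistoryLaw P π I (t + 1)) (seedHistoryLaw P π J (t + 1))
        ≤ klDiv (seedHistoryLaw P π I t) (seedHistoryLaw P π J t) +
            ∫⁻ q, klDiv (I.roundRewards (π.arms t q)) (J.roundRewards (π.arms t q))
              ∂(seedHistoryLaw P π I t) := by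
          rw [seedHistoryLaw_succ, seedHistoryLaw_succ]
          refine (klDiv_map_le _ _ (by fun_prop)).trans_eq ?_
          rw [klDiv_compProd_eq_add, klDiv_compProd_eq_lintegral]
          rfl
      _ ≤ ∫⁻ q, pullSum D q.2 ∂(seedHistoryLaw P π I t) +
            ∫⁻ q, ∑ m, D m (π.act m t q) ∂(seedHistoryLaw P π I t) :=
          add_le_add ih (lintegral_mono hround)
      _ = ∫⁻ q, pullSum D q.2 ∂(seedHistoryLaw P π I (t + 1)) := by
          rw [← lintegral_add_left (by fun_prop), seedHistoryLaw_succ,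
            lintegral_map (by fun_prop) (by fun_prop), Measure.lintegral_compProd (by fun_prop)]
          simp only [pullSum_extend, lintegral_const, measure_univ, mul_one]

theorem klDiv_historyLaw_le (P : Measure S) [IsProbabilityMeasure P] (π : Policy S X M)
    (I J : Instance X M) {D : Fin M → X → ℝ≥0∞} (hD : ∀ m, Measurable (D m))
    (hIJ : ∀ m x, klDiv (I.reward m x) (J.reward m x) ≤ D m x) (T : ℕ) :
    klDiv (historyLaw P π I T) (historyLaw P π J T) ≤
      ∫⁻ h, pullSum D h ∂(historyLaw P π I T) := by
  rw [← map_snd_seedHistoryLaw, ← map_snd_seedHistoryLaw,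
    lintegral_map (measurable_pullSum hD) measurable_snd]
  exact (klDiv_map_le _ _ measurable_snd).trans (klDiv_seedHistoryLaw_le P π I J hD hIJ T)

theorem integral_pullCount_le_add (P : Measure S) [IsProbabilityMeasure P] (π : Policy S X M)
    (I J : Instance X M) {C : Set X} (hC : MeasurableSet C) {v : ℝ} (hv : 0 ≤ v)
    (hIJ : ∀ m x, klDiv (I.reward m x) (J.reward m x) ≤ ENNReal.ofReal (v * C.indicator 1 x))
    (T : ℕ) :
    ∫ h, pullCount C h ∂(historyLaw P π J T) ≤ ∫ h, pullCount C h ∂(historyLaw P π I T) +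
      2 * (T * M) * √(v * ∫ h, pullCount C h ∂(historyLaw P π I T)) := by
  have hsum (h : History X M T) : pullSum (fun _ x => ENNReal.ofReal (v * C.indicator 1 x)) h =
      ENNReal.ofReal (v * pullCount C h) := by
    have hnonneg (x : X) : 0 ≤ v * C.indicator 1 x :=
      mul_nonneg hv (Set.indicator_nonneg (fun _ _ => zero_le_one) x)
    simp only [pullCount, pullSum, Finset.mul_sum]
    rw [ENNReal.ofReal_sum_of_nonneg fun _ _ => Finset.sum_nonneg fun _ _ => hnonneg _]
    exact Finset.sum_congr rfl fun _ _ =>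
      (ENNReal.ofReal_sum_of_nonneg fun _ _ => hnonneg _).symm
  have hkl : klDiv (historyLaw P π I T) (historyLaw P π J T) ≤
      ENNReal.ofReal (v * ∫ h, pullCount C h ∂(historyLaw P π I T)) := by
    refine (klDiv_historyLaw_le P π I J (fun _ => ?_) hIJ T).trans_eq ?_
    · exact ((measurable_one.indicator hC).const_mul v).ennreal_ofReal
    · rw [← integral_const_mul, ofReal_integral_eq_lintegral_ofReal
        ((integrable_pullCount hC _).const_mul v)
        (.of_forall fun h => mul_nonneg hv (pullCount_nonneg C h))]
      simp only [hsum]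
  have hdiff := abs_integral_sub_integral_le (ne_top_of_le_ne_top ENNReal.ofReal_ne_top hkl)
    (measurable_pullCount hC) (B := T * M) fun h => by
      rw [abs_of_nonneg (pullCount_nonneg C h)]
      exact pullCount_le C h
  have hroot : √(klDiv (historyLaw P π I T) (historyLaw P π J T)).toReal ≤
      √(v * ∫ h, pullCount C h ∂(historyLaw P π I T)) :=
    Real.sqrt_le_sqrt <| ENNReal.toReal_le_of_le_ofReal
      (mul_nonneg hv (integral_nonneg (pullCount_nonneg C))) hkl
  have hroot' := mul_le_mul_of_nonneg_left hroot (by positivity : (0 : ℝ) ≤ 2 * (T * M))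
  linarith [(abs_le.1 hdiff).1]

end Histories

section Regret

open InformationTheory

variable {S : Type*} [MeasurableSpace S] {X : Type} [MeasurableSpace X] {M : ℕ}

theorem Instance.localObjective_mem_Icc (I : Instance X M) (m : Fin M) (x : X) :
    I.localObjective m x ∈ Set.Icc (0 : ℝ) 1 := by
  refine ⟨integral_nonneg_of_ae ((I.bounded m x).mono fun r hr => hr.1), ?_⟩
  simpa [Instance.localObjective] using integral_mono_of_nonneg
    ((I.bounded m x).mono fun r hr => hr.1) (integrable_const (1 : ℝ))
    ((I.bounded m x).mono fun r hr => hr.2)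

theorem Instance.globalObjective_mem_Icc (I : Instance X M) (x : X) :
    I.globalObjective x ∈ Set.Icc (0 : ℝ) 1 := by
  refine ⟨div_nonneg (Finset.sum_nonneg fun m _ => (I.localObjective_mem_Icc m x).1)
    M.cast_nonneg, div_le_one_of_le₀ ?_ M.cast_nonneg⟩
  simpa using Finset.sum_le_sum fun m (_ : m ∈ Finset.univ) => (I.localObjective_mem_Icc m x).2

theorem Instance.globalObjective_le_iSup (I : Instance X M) (x : X) :
    I.globalObjective x ≤ ⨆ y, I.globalObjective y :=
  le_ciSup ⟨1, Set.forall_mem_range.2 fun y => (I.globalObjective_mem_Icc y).2⟩ x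

theorem Instance.measurable_globalObjective (I : Instance X M) : Measurable I.globalObjective := by
  have hlocal (m : Fin M) : Measurable (I.localObjective m) :=
    (stronglyMeasurable_id.integral_kernel (κ := I.reward m)).measurable
  exact (Finset.measurable_fun_sum _ fun m _ => hlocal m).div_const _

theorem Instance.integrable_regret (I : Instance X M) {t : ℕ} (μ : Measure (History X M t))
    [IsFiniteMeasure μ] : Integrable I.regret μ := by
  refine integrable_finsetSum _ fun i _ => integrable_finsetSum _ fun m _ =>
    (integrable_const _).sub (.of_bound ?_ 1 (.of_forall fun h => ?_))
  · have := I.measurable_globalObjective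
    exact Measurable.aestronglyMeasurable (by fun_prop)
  · have := I.globalObjective_mem_Icc (h i m).1
    rw [Real.norm_of_nonneg this.1]
    exact this.2

theorem Instance.mul_sub_pullCount_le_regret (I : Instance X M) {C : Set X} {Δ : ℝ}
    (hgap : ∀ x ∉ C, I.globalObjective x + Δ ≤ ⨆ y, I.globalObjective y) {t : ℕ}
    (h : History X M t) : Δ * (t * M - pullCount C h) ≤ I.regret h := by
  calc Δ * (t * M - pullCount C h) = ∑ i, ∑ m, Δ * (1 - C.indicator 1 (h i m).1) := by
        simp [← Finset.mul_sum, Finset.sum_sub_distrib, pullCount, pullSum]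
    _ ≤ I.regret h := Finset.sum_le_sum fun i _ => Finset.sum_le_sum fun m _ => by
        by_cases hC : (h i m).1 ∈ C
        · simpa [hC] using I.globalObjective_le_iSup _
        · simpa [hC, le_sub_iff_add_le'] using hgap _ hC

theorem mul_sub_integral_pullCount_le_expectedRegret (P : Measure S) [IsProbabilityMeasure P]
    (π : Policy S X M) (I : Instance X M) {C : Set X} (hC : MeasurableSet C) {Δ : ℝ}
    (hgap : ∀ x ∉ C, I.globalObjective x + Δ ≤ ⨆ y, I.globalObjective y) (T : ℕ) :
    Δ * (T * M - ∫ h, pullCount C h ∂(historyLaw P π I T)) ≤ expectedRegret P π I T := by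
  have hcount := integrable_pullCount hC (historyLaw P π I T)
  calc Δ * (T * M - ∫ h, pullCount C h ∂(historyLaw P π I T))
      = ∫ h, Δ * (T * M - pullCount C h) ∂(historyLaw P π I T) := by
        rw [integral_const_mul, integral_sub (integrable_const _) hcount]
        simp
    _ ≤ expectedRegret P π I T :=
        integral_mono (((integrable_const _).sub hcount).const_mul _) (I.integrable_regret _)
          (I.mul_sub_pullCount_le_regret hgap)

theorem exists_le_expectedRegret (P : Measure S) [IsProbabilityMeasure P] (π : Policy S X M)
    {ι : Type*} [Fintype ι] (hι : 2 ≤ Fintype.card ι) (I₀ : Instance X M) (I : ι → Instance X M)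
    {C : ι → Set X} (hC : ∀ i, MeasurableSet (C i))
    (hdisj : Pairwise (Function.onFun Disjoint C)) {v Δ : ℝ} (hv : 0 ≤ v) (hΔ : 0 ≤ Δ)
    (hkl : ∀ i m x, klDiv (I₀.reward m x) ((I i).reward m x) ≤
      ENNReal.ofReal (v * (C i).indicator 1 x))
    (hgap : ∀ i, ∀ x ∉ C i, (I i).globalObjective x + Δ ≤ ⨆ y, (I i).globalObjective y)
    {T : ℕ} (hT : 64 * v * (T * M) ≤ Fintype.card ι) :
    ∃ i, Δ * (T * M / 4) ≤ expectedRegret P π (I i) T := by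
  have : Nonempty ι := Fintype.card_pos_iff.1 (by omega)
  have hι' : (2 : ℝ) ≤ Fintype.card ι := by exact_mod_cast hι
  have hTM : (0 : ℝ) ≤ T * M := by positivity
  obtain ⟨i, hi⟩ := exists_integral_pullCount_le hC hdisj (historyLaw P π I₀ T)
  refine ⟨i, le_trans ?_
    (mul_sub_integral_pullCount_le_expectedRegret P π (I i) (hC i) (hgap i) T)⟩
  have htransfer := integral_pullCount_le_add P π I₀ (I i) (hC i) hv (hkl i) T
  set N₀ := ∫ h, pullCount (C i) h ∂(historyLaw P π I₀ T)
  have hhalf : N₀ ≤ T * M / 2 := hi.trans (div_le_div_of_nonneg_left hTM zero_lt_two hι')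
  have hroot : √(v * N₀) ≤ 1 / 8 := by
    refine Real.sqrt_le_iff.2 ⟨by norm_num, ?_⟩
    calc v * N₀ ≤ v * (T * M / Fintype.card ι) := mul_le_mul_of_nonneg_left hi hv
      _ = 64 * v * (T * M) / Fintype.card ι / 64 := by ring
      _ ≤ 1 / 64 := by gcongr; exact (div_le_one (by linarith)).2 hT
      _ = (1 / 8) ^ 2 := by norm_num
  have hroot' := mul_le_mul_of_nonneg_left hroot (by positivity : (0 : ℝ) ≤ 2 * (T * M))
  exact mul_le_mul_of_nonneg_left (by linarith) hΔ

end Regret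

section BernoulliInstances

variable {X : Type} [MeasurableSpace X]

/-- The kernel which sends `x` to the Bernoulli law on `{0, 1}` with mean `f x`. -/
def bernoulliKernel (f : X → unitInterval) (hf : Measurable f) : Kernel X ℝ where
  toFun x := bernoulliMeasure 1 0 (f x)
  measurable' := Measure.measurable_of_measurable_coe _ fun s _ => by
    simp only [bernoulliMeasure_eq_ofReal_smul_dirac, Measure.add_apply, Measure.smul_apply,
      smul_eq_mul]
    fun_prop

/-- The instance in which the rewards of all the clients are Bernoulli with mean `f x`. -/
def bernoulliInstance (M : ℕ) (f : X → unitInterval) (hf : Measurable f) : Instance X M where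
  reward _ := bernoulliKernel f hf
  isMarkov _ := ⟨fun x => inferInstanceAs (IsProbabilityMeasure (bernoulliMeasure 1 0 (f x)))⟩
  bounded _ x := by
    change ∀ᵐ r ∂(bernoulliMeasure 1 0 (f x)), r ∈ Set.Icc (0 : ℝ) 1
    rw [bernoulliMeasure_eq_ofReal_smul_dirac, ae_add_measure_iff]
    constructor <;> refine Measure.ae_smul_measure ?_ _ <;> simp [ae_dirac_eq]

/-- The bandit instance in which every reward is a fair coin flip. -/
def fairInstance (X : Type) [MeasurableSpace X] (M : ℕ) : Instance X M :=
  bernoulliInstance M (fun _ => ⟨1 / 2, by norm_num, by norm_num⟩) measurable_const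

theorem localObjective_bernoulliInstance {M : ℕ} (f : X → unitInterval) (hf : Measurable f)
    (m : Fin M) (x : X) : (bernoulliInstance M f hf).localObjective m x = f x := by
  change ∫ r, r ∂(bernoulliMeasure (1 : ℝ) 0 (f x)) = f x
  rw [integral_bernoulliMeasure]
  simp

theorem globalObjective_bernoulliInstance {M : ℕ} (hM : 1 ≤ M) (f : X → unitInterval)
    (hf : Measurable f) (x : X) : (bernoulliInstance M f hf).globalObjective x = f x := by
  have hM' : (M : ℝ) ≠ 0 := by positivity
  simp [Instance.globalObjective, localObjective_bernoulliInstance, mul_div_cancel_left₀ _ hM']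

end BernoulliInstances

section Bumps

variable {X : Type} [PseudoMetricSpace X]

/-- The mean reward `1 / 2`, raised by a cone of height and radius `ε` around `c` and truncated
to `[0, 1]`. -/
def bumpMean (ε : ℝ) (c x : X) : unitInterval :=
  Set.projIcc 0 1 zero_le_one (1 / 2 + max 0 (ε - dist x c))

theorem lipschitzWith_bumpMean (ε : ℝ) (c : X) : LipschitzWith 1 (bumpMean ε c) := by
  have hcone : LipschitzWith 1 fun x : X => 1 / 2 + max 0 (ε - dist x c) := by
    refine LipschitzWith.of_dist_le_mul fun x y => ?_
    calc dist (1 / 2 + max 0 (ε - dist x c)) (1 / 2 + max 0 (ε - dist y c))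
        ≤ |ε - dist x c - (ε - dist y c)| := by
          rw [dist_add_left, Real.dist_eq]
          simpa using abs_max_sub_max_le_max 0 (ε - dist x c) 0 (ε - dist y c)
      _ = |dist x c - dist y c| := by rw [sub_sub_sub_cancel_left, abs_sub_comm]
      _ ≤ (1 : NNReal) * dist x y := by
          rw [NNReal.coe_one, one_mul]
          exact abs_dist_sub_le x y c
  exact one_mul (1 : NNReal) ▸ (LipschitzWith.projIcc zero_le_one).comp hcone

theorem coe_bumpMean {ε : ℝ} (hε : ε ≤ 1 / 2) (c x : X) :
    (bumpMean ε c x : ℝ) = 1 / 2 + max 0 (ε - dist x c) := by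
  have hmax : max 0 (ε - dist x c) ≤ 1 / 2 :=
    max_le (by norm_num) (by linarith [dist_nonneg (x := x) (y := c)])
  rw [bumpMean, Set.projIcc_of_mem zero_le_one
    ⟨by linarith [le_max_left 0 (ε - dist x c)], by linarith⟩]

variable [MeasurableSpace X] [OpensMeasurableSpace X]

theorem measurable_bumpMean (ε : ℝ) (c : X) : Measurable (bumpMean ε c) :=
  (lipschitzWith_bumpMean ε c).continuous.measurable

/-- The bandit instance with Bernoulli rewards of mean `bumpMean ε c`, whose best arm is `c`. -/
def bumpInstance (M : ℕ) (ε : ℝ) (c : X) : Instance X M :=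
  bernoulliInstance M (bumpMean ε c) (measurable_bumpMean ε c)

variable {M : ℕ}

theorem localObjective_bumpInstance (hM : 1 ≤ M) (ε : ℝ) (c : X) (m : Fin M) :
    (bumpInstance M ε c).localObjective m = (bumpInstance M ε c).globalObjective :=
  funext fun x => (localObjective_bernoulliInstance _ _ m x).trans
    (globalObjective_bernoulliInstance hM _ _ x).symm

theorem lipschitzWith_globalObjective_bumpInstance (hM : 1 ≤ M) (ε : ℝ) (c : X) :
    LipschitzWith 1 (bumpInstance M ε c).globalObjective := by
  have hmean : (bumpInstance M ε c).globalObjective = Subtype.val ∘ bumpMean ε c :=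
    funext (globalObjective_bernoulliInstance hM _ _)
  rw [hmean]
  simpa only [one_mul] using (LipschitzWith.subtype_val _).comp (lipschitzWith_bumpMean ε c)

theorem globalObjective_bumpInstance_add_le_iSup (hM : 1 ≤ M) {ε : ℝ} (hε : ε ≤ 1 / 2) {c x : X}
    (hx : x ∉ Metric.ball c ε) : (bumpInstance M ε c).globalObjective x + ε ≤
      ⨆ y, (bumpInstance M ε c).globalObjective y := by
  rw [Metric.mem_ball, not_lt] at hx
  refine le_trans ?_ ((bumpInstance M ε c).globalObjective_le_iSup c)
  rw [bumpInstance, globalObjective_bernoulliInstance hM, globalObjective_bernoulliInstance hM,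
    coe_bumpMean hε, coe_bumpMean hε, max_eq_left (by linarith), dist_self, sub_zero]
  linarith [le_max_right 0 ε]

theorem klDiv_reward_fairInstance_bumpInstance_le {ε : ℝ} (hε : 0 ≤ ε) (hε' : ε ≤ 1 / 4) (c x : X)
    (m : Fin M) : InformationTheory.klDiv ((fairInstance X M).reward m x)
      ((bumpInstance M ε c).reward m x) ≤
        ENNReal.ofReal (6 * ε ^ 2 * (Metric.ball c ε).indicator 1 x) := by
  set b := max 0 (ε - dist x c)
  have hb : 0 ≤ b := le_max_left _ _
  have hbε : b ≤ ε := max_le hε (sub_le_self ε dist_nonneg)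
  have hsq : b ^ 2 ≤ ε ^ 2 * (Metric.ball c ε).indicator 1 x := by
    by_cases hx : x ∈ Metric.ball c ε
    · rw [Set.indicator_of_mem hx, Pi.one_apply, mul_one]
      exact pow_le_pow_left₀ hb hbε 2
    · have hb0 : b = 0 := max_eq_left (by rwa [Metric.mem_ball, not_lt, ← sub_nonpos] at hx)
      rw [Set.indicator_of_notMem hx, hb0, mul_zero, zero_pow two_ne_zero]
  have hmean : (bumpMean ε c x : ℝ) = 1 / 2 + b := coe_bumpMean (by linarith) c x
  refine (klDiv_bernoulliMeasure_le one_ne_zero _ (by linarith) (by linarith)).trans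
    (ENNReal.ofReal_le_ofReal ?_)
  have hvar : 3 / 16 ≤ (1 / 2 + b) * (1 - (1 / 2 + b)) := by nlinarith
  rw [hmean, div_le_iff₀ (by linarith)]
  nlinarith [mul_le_mul hsq hvar (by norm_num) ((sq_nonneg b).trans hsq)]

theorem exists_bumpInstance_le_expectedRegret {S : Type*} [MeasurableSpace S] (P : Measure S)
    [IsProbabilityMeasure P] (π : Policy S X M) (hM : 1 ≤ M) (T : ℕ) {ι : Type*} [Fintype ι]
    (hι : 2 ≤ Fintype.card ι) {ε : ℝ} (hε : 0 ≤ ε) (hε' : ε ≤ 1 / 4) {c : ι → X}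
    (hc : Pairwise fun i j => 2 * ε ≤ dist (c i) (c j))
    (hT : 384 * ε ^ 2 * (T * M) ≤ Fintype.card ι) :
    ∃ i, ε * (T * M / 4) ≤ expectedRegret P π (bumpInstance M ε (c i)) T :=
  exists_le_expectedRegret P π hι (fairInstance X M) (fun i => bumpInstance M ε (c i))
    (C := fun i => Metric.ball (c i) ε) (fun _ => Metric.isOpen_ball.measurableSet)
    (fun _ _ hij => Metric.ball_disjoint_ball (by linarith [hc hij])) (v := 6 * ε ^ 2)
    (by positivity) hε
    (fun i m x => klDiv_reward_fairInstance_bumpInstance_le hε hε' (c i) x m)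
    (fun _ _ hx => globalObjective_bumpInstance_add_le_iSup hM (by linarith) hx)
    (by linarith)

end Bumps

section Grid

/-- The centres of the `K ^ d` cells of the regular grid in `[0,1]^d`. -/
def gridCenter {d K : ℕ} (i : Fin d → Fin K) : Cube d := fun j =>
  ⟨(2 * (i j : ℝ) + 1) / (2 * K), by
    have h : ((i j : ℕ) : ℝ) + 1 ≤ K := by exact_mod_cast (i j).isLt
    have hK : (0 : ℝ) < K := by positivity [(i j).pos]
    exact ⟨by positivity, (div_le_one (by positivity)).2 (by linarith)⟩⟩

theorem inv_le_dist_gridCenter {d K : ℕ} {i j : Fin d → Fin K} (h : i ≠ j) :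
    (K : ℝ)⁻¹ ≤ dist (gridCenter i) (gridCenter j) := by
  obtain ⟨a, ha⟩ := Function.ne_iff.1 h
  have hK : (0 : ℝ) < K := by exact_mod_cast (i a).pos
  have hsub : (gridCenter i a - gridCenter j a : ℝ) = (((i a : ℤ) - (j a : ℤ) : ℤ) : ℝ) / K := by
    simp only [gridCenter]
    push_cast
    field_simp
    ring
  have hne : (i a : ℤ) - (j a : ℤ) ≠ 0 := by
    have := Fin.val_ne_of_ne ha
    omega
  have hone : (1 : ℝ) ≤ |(((i a : ℤ) - (j a : ℤ) : ℤ) : ℝ)| := by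
    exact_mod_cast Int.one_le_abs hne
  calc (K : ℝ)⁻¹ ≤ |(((i a : ℤ) - (j a : ℤ) : ℤ) : ℝ)| / K := by
        rw [← one_div]
        gcongr
    _ = dist (gridCenter i a) (gridCenter j a) := by
        rw [Subtype.dist_eq, Real.dist_eq, hsub, abs_div, abs_of_pos hK]
    _ ≤ dist (gridCenter i) (gridCenter j) := dist_le_pi_dist _ _ a

theorem exists_gridResolution {d : ℕ} (hd : 1 ≤ d) {N : ℝ} (hN : 1 ≤ N) :
    ∃ K : ℕ, 2 ≤ K ∧ 24 * N ≤ (K : ℝ) ^ (d + 2) ∧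
      1 / 64 * N ^ ((d + 1 : ℝ) / (d + 2)) ≤ 1 / (4 * K) * (N / 4) := by
  set y : ℝ := N ^ (1 / (d + 2 : ℝ)) with hy
  have hy1 : 1 ≤ y := Real.one_le_rpow hN (by positivity)
  have hypow : y ^ (d + 2) = N := by
    rw [hy, ← Real.rpow_natCast, ← Real.rpow_mul (by linarith), Nat.cast_add, Nat.cast_two,
      one_div_mul_cancel (by positivity), Real.rpow_one]
  have hysplit : N ^ ((d + 1 : ℝ) / (d + 2)) * y = N := by
    have hexp : (d + 1 : ℝ) / (d + 2) + 1 / (d + 2) = 1 := by field_simp; ring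
    rw [hy, ← Real.rpow_add (by linarith), hexp, Real.rpow_one]
  -- The factor 3 is the least integer with `24 ≤ 3 ^ (d + 2)` for every `d ≥ 1`.
  have hle := Nat.le_ceil (3 * y)
  have hlt := Nat.ceil_lt_add_one (by linarith : 0 ≤ 3 * y)
  set K := ⌈3 * y⌉₊
  refine ⟨K, ?_, ?_, ?_⟩
  · exact_mod_cast (by linarith : (2 : ℝ) ≤ K)
  · calc 24 * N ≤ 3 ^ (d + 2) * N := by
          gcongr
          exact (by norm_num : (24 : ℝ) ≤ 3 ^ 3).trans
            (pow_le_pow_right₀ (by norm_num) (by omega))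
      _ = (3 * y) ^ (d + 2) := by rw [mul_pow, hypow]
      _ ≤ (K : ℝ) ^ (d + 2) := by gcongr
  · have hpow : 0 ≤ N ^ ((d + 1 : ℝ) / (d + 2)) := Real.rpow_nonneg (by linarith) _
    have hK := mul_le_mul_of_nonneg_left (by linarith : (K : ℝ) ≤ 4 * y) hpow
    have hdiv : 1 / (4 * K) * (N / 4) = N / (16 * K) := by ring
    rw [hdiv, le_div_iff₀ (by linarith)]
    linarith

theorem exists_cube_bumpInstance_le_expectedRegret {S : Type*} [MeasurableSpace S] (P : Measure S)
    [IsProbabilityMeasure P] {d M T : ℕ} (hd : 1 ≤ d) (hM : 1 ≤ M) (hT : 1 ≤ T)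
    (π : Policy S (Cube d) M) :
    ∃ ε c, 1 / 64 * (T * M : ℝ) ^ ((d + 1 : ℝ) / (d + 2)) ≤
      expectedRegret P π (bumpInstance M ε c) T := by
  have hTM : (1 : ℝ) ≤ T * M := by exact_mod_cast Nat.mul_pos hT hM
  obtain ⟨K, hK2, hKpow, hregret⟩ := exists_gridResolution hd hTM
  have hK2' : (2 : ℝ) ≤ K := by exact_mod_cast hK2
  have hcard : Fintype.card (Fin d → Fin K) = K ^ d := by simp
  have hε : (1 : ℝ) / (4 * K) ≤ 1 / 4 :=
    div_le_div_of_nonneg_left zero_le_one (by norm_num) (by linarith)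
  have hseparated : Pairwise fun i j : Fin d → Fin K =>
      2 * (1 / (4 * K : ℝ)) ≤ dist (gridCenter i) (gridCenter j) := fun i j hij => by
    refine le_trans ?_ (inv_le_dist_gridCenter hij)
    rw [← one_div, mul_one_div]
    exact (div_le_div_iff₀ (by linarith) (by linarith)).2 (by linarith)
  have hmany : 384 * (1 / (4 * K : ℝ)) ^ 2 * (T * M) ≤ Fintype.card (Fin d → Fin K) := by
    have hsquare : 384 * (1 / (4 * K : ℝ)) ^ 2 * (T * M) = 24 * (T * M) / K ^ 2 := by
      field_simp
      norm_num
    rw [hsquare, hcard, Nat.cast_pow, div_le_iff₀ (by positivity), ← pow_add]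
    exact hKpow
  obtain ⟨i, hi⟩ := exists_bumpInstance_le_expectedRegret P π hM T
    (hcard ▸ hK2.trans (Nat.le_self_pow (by omega) K)) (by positivity) hε hseparated hmany
  exact ⟨_, _, hregret.trans hi⟩

end Grid

end

end FedBandit

theorem mainTheorem3 :
    ∃ c : ℝ, 0 < c ∧
      ∀ (d M T : ℕ), 1 ≤ d → 1 ≤ M → 1 ≤ T →
      ∀ (S : Type*) [MeasurableSpace S] (P : MeasureTheory.Measure S)
        [MeasureTheory.IsProbabilityMeasure P]
        (π : FedBandit.Policy S (FedBandit.Cube d) M),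
      ∃ I : FedBandit.Instance (FedBandit.Cube d) M,
        (∀ m, I.localObjective m = I.globalObjective) ∧
        LipschitzWith 1 I.globalObjective ∧
        c * (M : ℝ) ^ (((d : ℝ) + 1) / ((d : ℝ) + 2)) * (T : ℝ) ^ (((d : ℝ) + 1) / ((d : ℝ) + 2))
          ≤ FedBandit.expectedRegret P π I T := by
  refine ⟨1 / 64, by norm_num, fun d M T hd hM hT S _ P _ π => ?_⟩
  obtain ⟨ε, c, hregret⟩ := FedBandit.exists_cube_bumpInstance_le_expectedRegret P hd hM hT π
  refine ⟨FedBandit.bumpInstance M ε c, FedBandit.localObjective_bumpInstance hM ε c,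
    FedBandit.lipschitzWith_globalObjective_bumpInstance hM ε c, ?_⟩
  rwa [mul_assoc, ← Real.mul_rpow M.cast_nonneg T.cast_nonneg, mul_comm (M : ℝ)]
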